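/- Conventions. An ideal $\mathcal N$ of a category is a class of morphisms such that $fgh\in\mathcal N$ whenever $g\in\mathcal N$ and the composite is defined. A (weak) $\mathcal N$-kernel of $f$ is a morphism $k$ with $fk\in\mathcal N$ through which every $k'$ with $fk'\in\mathcal N$ factors uniquely (resp. factors). A pair $f_1,f_2:X\to Y$ satisfies $(\ast\pi_0)$ with respect to $\mathcal N$ if for every weak $\mathcal N$-kernel $k$ of $f_1$ and every $g:Y\to Z$ one has $gf_1k=gf_2k\iff gf_1=gf_2$; a reflexive graph $d,c:G_1\rightrightarrows G_0$ (with a common section $e$, $de=ce=1_{G_0}$) satisfies $(\ast\pi_0)$ if the pair $(d,c)$ does. A regular category $\mathbb C$ with an ideal $\mathcal N$ admitting kernels is star-regular if every regular epimorphism $f$ is a coequalizer of $(p_1k,p_2k)$, where $(p_1,p_2)$ is the kernel pair of $f$ and $k$ is an $\mathcal N$-kernel of $p_1$. A pointed regular category is normal if every regular epimorphism is a normal epimorphism (a cokernel of some morphism). A projective cover of a regular category $\mathbb C$ is a full subcategory $\mathbb P$ whose objects are projective with respect to regular epimorphisms of $\mathbb C$ and such that every object of $\mathbb C$ admits a regular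 epimorphism from an object of $\mathbb P$. The exact completion of a category $\mathbb P$ with weak finite limits has as objects the pseudo-equivalence relations $r_1,r_2:R\rightrightarrows X$ in $\mathbb P$ (reflexive, symmetric and transitive pairs, not necessarily jointly monic); a morphism from $(r_1,r_2:R\rightrightarrows X)$ to $(s_1,s_2:S\rightrightarrows Y)$ is an equivalence class of morphisms $f:X\to Y$ for which there is $\bar f:R\to S$ with $s_i\bar f=fr_i$ ($i=1,2$), where $f\sim g$ if there is $h:X\to S$ with $s_1h=f$ and $s_2h=g$. Let $\mathbb C$ be the variety of algebras with a binary operation $d$, a constant $0$ and the single identity $d(x,x)=0$; let $\mathbb C'$ be the quasi-variety of those algebras in $\mathbb C$ that satisfy $d(x,y)=0\Rightarrow x=y$; and let $\mathbb P$ be the full subcategory of $\mathbb C$ consisting of the free algebras. All three categories are pointed, the null morphisms being the constant maps with value $0$. Then: 1. $\mathbb C$ is a (Barr-)exact, in particular regular, category with kernels. 2. $\mathbb P$ is a projective cover of $\mathbb C$; moreover every free algebra lies in $\mathbb C'$, and $\mathbb P$ is also a projective cover of the regular category $\mathbb C'$. 3. $\mathbb C'$ is a normal category. 4. $\mathbb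 P$ has weak finite limits and weak kernels, and every reflexive graph in $\mathbb P$ satisfies $(\ast\pi_0)$ for the ideal of null morphisms. 5. $\mathbb C$ is not normal; equivalently, $\mathbb C$ with its ideal of null morphisms is not star-regular. 6. Consequently the following implication does not hold in general: if $\mathbb D$ is a regular category with an ideal $\mathcal N$ admitting kernels, $\mathbb Q$ is a projective cover of $\mathbb D$, and every reflexive graph in $\mathbb Q$ satisfies $(\ast\pi_0)$ with respect to the restriction of $\mathcal N$ to $\mathbb Q$, then $(\mathbb D,\mathcal N)$ is star-regular. 7. The exact completion of $\mathbb P$ is equivalent to $\mathbb C$, compatibly with the embeddings of $\mathbb P$, and it is not a normal category. -/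

import Mathlib

open CategoryTheory CategoryTheory.Limits

universe u v w

section Ideals

variable {C : Type w} [Category.{v} C]

/-- An ideal of a category: a class of morphisms `N` such that a composite of three morphisms
belongs to `N` as soon as the middle one does. -/
def IsMorphismIdeal (N : MorphismProperty C) : Prop :=
  ∀ ⦃W X Y Z : C⦄ (h : W ⟶ X) (g : X ⟶ Y) (f : Y ⟶ Z), N g → N (h ≫ g ≫ f)

/-- `k` is a weak `N`-kernel of `f`. -/
def IsWeakIdealKernel (N : MorphismProperty C) {K X Y : C} (f : X ⟶ Y) (k : K ⟶ X) : Prop :=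
  N (k ≫ f) ∧ ∀ ⦃K' : C⦄ (k' : K' ⟶ X), N (k' ≫ f) → ∃ t : K' ⟶ K, t ≫ k = k'

/-- `k` is an `N`-kernel of `f`. -/
def IsIdealKernel (N : MorphismProperty C) {K X Y : C} (f : X ⟶ Y) (k : K ⟶ X) : Prop :=
  N (k ≫ f) ∧ ∀ ⦃K' : C⦄ (k' : K' ⟶ X), N (k' ≫ f) → ∃! t : K' ⟶ K, t ≫ k = k'

def HasIdealKernels (N : MorphismProperty C) : Prop :=
  ∀ ⦃X Y : C⦄ (f : X ⟶ Y), ∃ (K : C) (k : K ⟶ X), IsIdealKernel N f k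

def HasWeakIdealKernels (N : MorphismProperty C) : Prop :=
  ∀ ⦃X Y : C⦄ (f : X ⟶ Y), ∃ (K : C) (k : K ⟶ X), IsWeakIdealKernel N f k

/-- The condition `(∗π₀)` for a pair `(f₁, f₂)` of parallel morphisms: for every weak `N`-star
`(f₁ k, f₂ k)` of the pair and every `g`, one has `g f₁ k = g f₂ k` iff `g f₁ = g f₂`. -/
def StarPiZero (N : MorphismProperty C) {X Y : C} (f₁ f₂ : X ⟶ Y) : Prop :=
  ∀ ⦃K : C⦄ (k : K ⟶ X), IsWeakIdealKernel N f₁ k →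
    ∀ ⦃Z : C⦄ (g : Y ⟶ Z), (k ≫ f₁ ≫ g = k ≫ f₂ ≫ g ↔ f₁ ≫ g = f₂ ≫ g)

/-- The underlying pair `(d, c)` of every reflexive graph satisfies `(∗π₀)`. -/
def ReflexiveGraphsSatisfyStarPiZero (N : MorphismProperty C) : Prop :=
  ∀ ⦃G₁ G₀ : C⦄ (d c : G₁ ⟶ G₀), IsReflexivePair d c → StarPiZero N d c

/-- A star-regular category: a regular category with an ideal admitting kernels, such that every
regular epimorphism `f` is a coequalizer of its kernel star `(p₁ k, p₂ k)`, where `(p₁, p₂)` is a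
kernel pair of `f` and `k` is an `N`-kernel of `p₁`. -/
structure IsStarRegular (N : MorphismProperty C) : Prop where
  regular : Regular C
  ideal : IsMorphismIdeal N
  kernels : HasIdealKernels N
  coequalizer : ∀ ⦃X Y : C⦄ (f : X ⟶ Y), IsRegularEpi f →
    ∀ ⦃R K : C⦄ (p₁ p₂ : R ⟶ X) (k : K ⟶ R), IsKernelPair f p₁ p₂ → IsIdealKernel N p₁ k →
      ∃ h : (k ≫ p₁) ≫ f = (k ≫ p₂) ≫ f, Nonempty (IsColimit (Cofork.ofπ f h))

end Ideals

section Pointed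

variable (C : Type w) [Category.{v} C] [HasZeroMorphisms C]

/-- The ideal of null morphisms of a pointed category (pointed: enriched in pointed sets). -/
def nullIdeal : MorphismProperty C := fun _ _ f => f = 0

theorem nullIdeal_isMorphismIdeal : IsMorphismIdeal (nullIdeal C) := by
  rintro W X Y Z h _ f rfl
  simp [nullIdeal]

theorem nullIdeal_existsUnique (X Y : C) : ∃! f : X ⟶ Y, nullIdeal C f :=
  ⟨0, rfl, fun _ h => h⟩

/-- A normal category: a pointed regular category in which every regular epimorphism is a normal
epimorphism. -/
structure IsNormalCategory : Prop where
  regular : Regular C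
  normalEpi : ∀ ⦃X Y : C⦄ (f : X ⟶ Y), IsRegularEpi f → Nonempty (NormalEpi f)

end Pointed

section Covers

/-- A Barr-exact category: a regular category in which every internal equivalence relation is a
kernel pair. -/
structure IsBarrExact (C : Type w) [Category.{v} C] : Prop where
  regular : Regular C
  effective : ∀ ⦃R X : C⦄ (p₁ p₂ : R ⟶ X), IsEquivalenceRelation p₁ p₂ →
    ∃ (Y : C) (f : X ⟶ Y), IsKernelPair f p₁ p₂

/-- The category `P`, embedded in the regular category `C` as a full subcategory by `F`, is a
projective cover of `C`. -/
structure IsProjectiveCover {P : Type*} [Category* P] {C : Type*} [Category* C] (F : P ⥤ C) :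
    Prop where
  regular : Regular C
  full : F.Full
  faithful : F.Faithful
  projective : ∀ (Q : P) ⦃X Y : C⦄ (f : X ⟶ Y), IsRegularEpi f →
    ∀ g : F.obj Q ⟶ Y, ∃ h : F.obj Q ⟶ X, h ≫ f = g
  enough : ∀ X : C, ∃ (Q : P) (e : F.obj Q ⟶ X), IsRegularEpi e

def HasWeakFiniteLimits (P : Type w) [Category.{v} P] : Prop :=
  ∀ (J : Type) [SmallCategory J] [FinCategory J], HasWeakLimitsOfShape J P

end Covers

section ExactCompletion

/-- A pseudo-equivalence relation: a pair `r₁, r₂ : R ⟶ X`, not required to be jointly monic,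
which is reflexive, symmetric and transitive. In the presence of weak pullbacks it is enough to ask
transitivity for a weak pullback of `(r₂, r₁)`. -/
structure PseudoEquivalenceRelation (P : Type w) [Category.{v} P] where
  X : P
  R : P
  r₁ : R ⟶ X
  r₂ : R ⟶ X
  refl : ∃ r : X ⟶ R, r ≫ r₁ = 𝟙 X ∧ r ≫ r₂ = 𝟙 X
  symm : ∃ s : R ⟶ R, s ≫ r₁ = r₂ ∧ s ≫ r₂ = r₁
  trans : ∀ ⦃T : P⦄ (a b : T ⟶ R), a ≫ r₂ = b ≫ r₁ →
    ∃ t : T ⟶ R, t ≫ r₁ = a ≫ r₁ ∧ t ≫ r₂ = b ≫ r₂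

/-- The exact completion of `P` (a category with weak finite limits): its objects are the
pseudo-equivalence relations in `P`. -/
structure ExactCompletion (P : Type w) [Category.{v} P] where
  rel : PseudoEquivalenceRelation P

namespace ExactCompletion

variable {P : Type w} [Category.{v} P]

/-- A morphism `f : X ⟶ Y` compatible with the pseudo-equivalence relations. -/
def PreHom (A B : ExactCompletion P) : Type v :=
  { f : A.rel.X ⟶ B.rel.X //
    ∃ g : A.rel.R ⟶ B.rel.R, g ≫ B.rel.r₁ = A.rel.r₁ ≫ f ∧ g ≫ B.rel.r₂ = A.rel.r₂ ≫ f }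

/-- Two compatible morphisms are identified when they are related by a morphism `X ⟶ S`, where
`S` is the pseudo-equivalence relation on the codomain. -/
def homSetoid (A B : ExactCompletion P) : Setoid (PreHom A B) where
  r f g := ∃ h : A.rel.X ⟶ B.rel.R, h ≫ B.rel.r₁ = f.1 ∧ h ≫ B.rel.r₂ = g.1
  iseqv :=
    { refl := fun f => by
        obtain ⟨r, h₁, h₂⟩ := B.rel.refl
        exact ⟨f.1 ≫ r, by simp [h₁], by simp [h₂]⟩
      symm := by
        rintro f g ⟨h, h₁, h₂⟩
        obtain ⟨s, s₁, s₂⟩ := B.rel.symm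
        exact ⟨h ≫ s, by simp [s₁, h₂], by simp [s₂, h₁]⟩
      trans := by
        rintro f g k ⟨h, h₁, h₂⟩ ⟨h', h₁', h₂'⟩
        obtain ⟨t, t₁, t₂⟩ := B.rel.trans h h' (h₂.trans h₁'.symm)
        exact ⟨t, t₁.trans h₁, t₂.trans h₂'⟩ }

def PreHom.id (A : ExactCompletion P) : PreHom A A := ⟨𝟙 _, 𝟙 _, by simp, by simp⟩

def PreHom.comp {A B D : ExactCompletion P} (f : PreHom A B) (g : PreHom B D) : PreHom A D :=
  ⟨f.1 ≫ g.1, by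
    obtain ⟨f', h₁, h₂⟩ := f.2
    obtain ⟨g', k₁, k₂⟩ := g.2
    exact ⟨f' ≫ g', by simp [k₁, reassoc_of% h₁], by simp [k₂, reassoc_of% h₂]⟩⟩

instance : Category.{v} (ExactCompletion P) where
  Hom A B := Quotient (homSetoid A B)
  id A := Quotient.mk _ (PreHom.id A)
  comp {A B D} := Quotient.map₂ PreHom.comp (by
    rintro f f' ⟨h, h₁, h₂⟩ g g' ⟨k, k₁, k₂⟩
    obtain ⟨l, l₁, l₂⟩ := g.2
    obtain ⟨t, t₁, t₂⟩ := D.rel.trans (h ≫ l) (f'.1 ≫ k) (by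
      simp [l₂, k₁, reassoc_of% h₂])
    refine ⟨t, ?_, ?_⟩
    · rw [t₁, Category.assoc, l₁, ← Category.assoc, h₁]; rfl
    · rw [t₂, Category.assoc, k₂]; rfl)
  id_comp := by
    rintro A B ⟨f⟩
    exact congrArg (Quotient.mk _) (Subtype.ext (Category.id_comp _))
  comp_id := by
    rintro A B ⟨f⟩
    exact congrArg (Quotient.mk _) (Subtype.ext (Category.comp_id _))
  assoc := by
    rintro A B D E ⟨f⟩ ⟨g⟩ ⟨h⟩
    exact congrArg (Quotient.mk _) (Subtype.ext (Category.assoc _ _ _))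

/-- The canonical embedding, sending `X` to the discrete relation `𝟙, 𝟙 : X ⟶ X`. -/
def embedding (P : Type w) [Category.{v} P] : P ⥤ ExactCompletion P where
  obj X := ⟨{ X := X, R := X, r₁ := 𝟙 X, r₂ := 𝟙 X
              refl := ⟨𝟙 X, by simp, by simp⟩
              symm := ⟨𝟙 X, by simp, by simp⟩
              trans := fun T a b h => ⟨a, by simp, by simpa using h⟩ }⟩
  map f := Quotient.mk _ ⟨f, f, by simp, by simp⟩
  map_id _ := rfl
  map_comp _ _ := rfl

/-- When `P` is pointed, so is its exact completion: null morphisms are the classes of null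
morphisms. -/
instance [HasZeroMorphisms P] : HasZeroMorphisms (ExactCompletion P) where
  zero A B := ⟨Quotient.mk _ ⟨0, 0, by simp, by simp⟩⟩
  comp_zero := by
    rintro A B ⟨f⟩ D
    exact congrArg (Quotient.mk _) (Subtype.ext comp_zero)
  zero_comp := by
    rintro A B D ⟨f⟩
    exact congrArg (Quotient.mk _) (Subtype.ext zero_comp)

end ExactCompletion

end ExactCompletion

/-- The algebras of the variety with a binary operation `d`, a constant `0`, and the identity
`d(x, x) = 0`. -/
structure DAlg : Type (u + 1) where
  carrier : Type u
  d : carrier → carrier → carrier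
  zero : carrier
  d_self : ∀ x, d x x = zero

namespace DAlg

/-- Homomorphisms of algebras. -/
@[ext]
structure Hom (A B : DAlg.{u}) : Type u where
  toFun : A.carrier → B.carrier
  map_d : ∀ x y, toFun (A.d x y) = B.d (toFun x) (toFun y)
  map_zero : toFun A.zero = B.zero

instance : Category.{u} DAlg.{u} where
  Hom A B := Hom A B
  id A := ⟨fun x => x, fun _ _ => rfl, rfl⟩
  comp f g := ⟨fun x => g.toFun (f.toFun x), fun x y => by rw [f.map_d, g.map_d],
    by rw [f.map_zero, g.map_zero]⟩

/-- The null morphisms are the constant maps with value `0`. -/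
instance : HasZeroMorphisms DAlg.{u} where
  zero A B := ⟨(⟨fun _ => B.zero, fun _ _ => (B.d_self _).symm, rfl⟩ : Hom A B)⟩
  comp_zero _ _ := rfl
  zero_comp _ _ _ f := Hom.ext (funext fun _ => f.map_zero)

/-- The quasi-identity `d(x, y) = 0 ⇒ x = y`. -/
def quasiIdentity : ObjectProperty DAlg.{u} := fun A => ∀ x y, A.d x y = A.zero → x = y

/-- The free algebras: those admitting a map from a set with the universal property. -/
def isFree : ObjectProperty DAlg.{u} := fun A =>
  ∃ (X : Type u) (i : X → A.carrier), ∀ (B : DAlg.{u}) (f : X → B.carrier),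
    ∃! h : Hom A B, ∀ x, h.toFun (i x) = f x

end DAlg

/-! The point is how much of a congruence the kernel detects. If f(x) = f(y), then d(x, y) lies in
the kernel of f, because d(z, z) = 0. A homomorphism g killing that kernel therefore satisfies
d(g(x), g(y)) = 0, and this forces g(x) = g(y) as soon as the codomain of g satisfies the
quasi-identity (`toFun_eq_of_kernel`). So surjections in the quasi-variety are cokernels of their
kernels. Free algebras satisfy the quasi-identity, by the normal form of reduced terms, so the same
computation gives the star condition for reflexive graphs of free algebras
(`isFree_reflexiveGraphsSatisfyStarPiZero`).

In the whole variety the last step breaks. When d is constantly 0, every pointed map is a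
homomorphism, so a surjection can have zero kernel without being injective
(`exists_surjective_kernel_zero_not_injective`). This one map refutes both normality and
star-regularity.

The free algebras are nevertheless a projective cover of both categories. Regularity and the cover
property are proved once for both, in the setting of `IsHereditary`, where regular epimorphisms are
the surjections. The exact completion is identified with the variety by sending a pseudo-equivalence
relation to its quotient. Fullness and faithfulness come from `isFree_exists_lift`, since a
homomorphism out of a free algebra may be prescribed on generators. -/

section Cofork

variable {C : Type w} [Category.{v} C]

/-- An epimorphism through which every morphism coequalizing `a` and `b` factors is a coequalizer
of `a` and `b`. -/
theorem nonempty_isColimit_cofork_of_exists_desc {W X Y : C} {a b : W ⟶ X} (f : X ⟶ Y) [Epi f]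
    (h : a ≫ f = b ≫ f) (desc : ∀ ⦃Z : C⦄ (g : X ⟶ Z), a ≫ g = b ≫ g → ∃ l : Y ⟶ Z, f ≫ l = g) :
    Nonempty (IsColimit (Cofork.ofπ f h)) := by
  choose l hl using desc
  exact ⟨Cofork.IsColimit.mk _ (fun s => l s.π s.condition) (fun s => hl _ _)
    fun s m hm => (cancel_epi f).1 ((hl _ _).symm ▸ hm)⟩

end Cofork

/-! ### Elementwise criteria for morphisms of algebras -/

namespace DAlg

theorem hom_ext {A B : DAlg.{u}} {f g : A ⟶ B} (h : ∀ x, f.toFun x = g.toFun x) : f = g :=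
  Hom.ext (funext h)

@[simp] theorem id_toFun (A : DAlg.{u}) (x : A.carrier) : Hom.toFun (𝟙 A) x = x := rfl

@[simp] theorem comp_toFun {A B D : DAlg.{u}} (f : A ⟶ B) (g : B ⟶ D) (x : A.carrier) :
    Hom.toFun (f ≫ g) x = g.toFun (f.toFun x) := rfl

@[simp] theorem zero_toFun {A B : DAlg.{u}} (x : A.carrier) :
    Hom.toFun (0 : A ⟶ B) x = B.zero := rfl

theorem inv_hom_toFun {A B : DAlg.{u}} (e : A ≅ B) (x : B.carrier) :
    e.hom.toFun (e.inv.toFun x) = x := by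
  rw [← comp_toFun, e.inv_hom_id, id_toFun]

theorem hom_inv_toFun {A B : DAlg.{u}} (e : A ≅ B) (x : A.carrier) :
    e.inv.toFun (e.hom.toFun x) = x := by
  rw [← comp_toFun, e.hom_inv_id, id_toFun]

theorem epi_of_surjective {A B : DAlg.{u}} (f : A ⟶ B) (hf : Function.Surjective f.toFun) :
    Epi f :=
  ⟨fun g h e => hom_ext fun x => by
    obtain ⟨y, rfl⟩ := hf x
    rw [← comp_toFun, e, comp_toFun]⟩

theorem mono_of_injective {A B : DAlg.{u}} (f : A ⟶ B) (hf : Function.Injective f.toFun) :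
    Mono f :=
  ⟨fun g h e => hom_ext fun x => hf (by rw [← comp_toFun, e, comp_toFun])⟩

/-- A homomorphism descends along a surjective homomorphism with smaller kernel congruence. -/
theorem exists_desc {A B D : DAlg.{u}} (f : A ⟶ B) (hf : Function.Surjective f.toFun) (g : A ⟶ D)
    (h : ∀ x y, f.toFun x = f.toFun y → g.toFun x = g.toFun y) : ∃ l : B ⟶ D, f ≫ l = g := by
  choose s hs using hf
  refine ⟨(⟨fun b => g.toFun (s b), fun x y => ?_, ?_⟩ : Hom B D), hom_ext fun x => h _ _ (hs _)⟩
  · rw [← g.map_d]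
    exact h _ _ (by rw [hs, f.map_d, hs, hs])
  · rw [← g.map_zero]
    exact h _ _ (by rw [hs, f.map_zero])

/-- A pair of homomorphisms lifts along a jointly injective pair with larger image. -/
theorem exists_lift₂ {A B B' D : DAlg.{u}} (p : A ⟶ B) (q : A ⟶ B')
    (hpq : ∀ a b, p.toFun a = p.toFun b → q.toFun a = q.toFun b → a = b) (f : D ⟶ B) (g : D ⟶ B')
    (h : ∀ x, ∃ a, p.toFun a = f.toFun x ∧ q.toFun a = g.toFun x) :
    ∃ l : D ⟶ A, l ≫ p = f ∧ l ≫ q = g := by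
  choose l hp hq using h
  refine ⟨(⟨l, fun x y => hpq _ _ ?_ ?_, hpq _ _ ?_ ?_⟩ : Hom D A), hom_ext hp, hom_ext hq⟩
  · rw [hp, p.map_d, hp, hp, f.map_d]
  · rw [hq, q.map_d, hq, hq, g.map_d]
  · rw [hp, p.map_zero, f.map_zero]
  · rw [hq, q.map_zero, g.map_zero]

/-- A homomorphism lifts along an injective homomorphism with larger image. -/
theorem exists_lift {A B D : DAlg.{u}} (m : A ⟶ B) (hm : Function.Injective m.toFun) (g : D ⟶ B)
    (h : ∀ x, ∃ a, m.toFun a = g.toFun x) : ∃ l : D ⟶ A, l ≫ m = g := by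
  obtain ⟨l, hl, -⟩ := exists_lift₂ m m (fun _ _ e _ => hm e) g g fun x =>
    (h x).imp fun _ e => ⟨e, e⟩
  exact ⟨l, hl⟩

theorem exists_iso_of_bijective {A B : DAlg.{u}} (f : A ⟶ B) (hf : Function.Bijective f.toFun) :
    ∃ e : A ≅ B, e.hom = f := by
  obtain ⟨l, hl⟩ := exists_desc f hf.2 (𝟙 A) fun x y h => hf.1 h
  have := epi_of_surjective f hf.2
  exact ⟨⟨f, l, hl, (cancel_epi f).1 (by rw [reassoc_of% hl, Category.comp_id])⟩, rfl⟩

/-! ### Subalgebras, kernels, quotients and limits -/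

/-- The subalgebra on a subset closed under the operations. -/
def sub (A : DAlg.{u}) (S : Set A.carrier) (h₀ : A.zero ∈ S)
    (hd : ∀ x ∈ S, ∀ y ∈ S, A.d x y ∈ S) : DAlg.{u} where
  carrier := S
  d x y := ⟨A.d x y, hd x x.2 y y.2⟩
  zero := ⟨A.zero, h₀⟩
  d_self x := Subtype.ext (A.d_self x)

/-- The inclusion of a subalgebra. -/
def subι (A : DAlg.{u}) (S : Set A.carrier) (h₀ : A.zero ∈ S)
    (hd : ∀ x ∈ S, ∀ y ∈ S, A.d x y ∈ S) : A.sub S h₀ hd ⟶ A :=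
  (⟨Subtype.val, fun _ _ => rfl, rfl⟩ : Hom _ _)

theorem exists_image {A B : DAlg.{u}} (f : A ⟶ B) :
    ∃ (I : DAlg.{u}) (e : A ⟶ I) (m : I ⟶ B), Function.Surjective e.toFun ∧
      Function.Injective m.toFun ∧ e ≫ m = f :=
  ⟨B.sub (Set.range f.toFun) ⟨A.zero, f.map_zero⟩ (by
      rintro _ ⟨x, rfl⟩ _ ⟨y, rfl⟩
      exact ⟨A.d x y, f.map_d x y⟩),
    (⟨fun x => (⟨f.toFun x, x, rfl⟩ : Set.range f.toFun), fun x y => Subtype.ext (f.map_d x y),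
      Subtype.ext f.map_zero⟩ : Hom _ _),
    subι _ _ _ _, fun ⟨_, x, hx⟩ => ⟨x, Subtype.ext hx⟩, Subtype.val_injective, rfl⟩

theorem exists_kernel {A B : DAlg.{u}} (f : A ⟶ B) :
    ∃ (K : DAlg.{u}) (k : K ⟶ A), Function.Injective k.toFun ∧
      ∀ x, f.toFun x = B.zero ↔ ∃ y, k.toFun y = x :=
  ⟨A.sub {x | f.toFun x = B.zero} f.map_zero (by
      intro x hx y hy
      rw [Set.mem_ofPred_eq] at hx hy ⊢
      -- The identity at 0 gives d(0, 0) = 0, so {0} is a subalgebra and so is its preimage.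
      rw [f.map_d, hx, hy, B.d_self]),
    subι _ _ _ _, Subtype.val_injective, fun x => ⟨fun h => ⟨⟨x, h⟩, rfl⟩, fun ⟨y, hy⟩ => hy ▸ y.2⟩⟩

theorem exists_isIdealKernel {A B : DAlg.{u}} (f : A ⟶ B) :
    ∃ (K : DAlg.{u}) (k : K ⟶ A), IsIdealKernel (nullIdeal DAlg.{u}) f k := by
  obtain ⟨K, k, hk, h⟩ := exists_kernel f
  refine ⟨K, k, hom_ext fun x => (h _).2 ⟨x, rfl⟩, fun K' k' h' => ?_⟩
  obtain ⟨l, hl⟩ := exists_lift k hk k' fun x => (h _).1 (by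
    rw [← comp_toFun, show k' ≫ f = 0 from h', zero_toFun])
  have := mono_of_injective k hk
  exact ⟨l, hl, fun t ht => (cancel_mono k).1 (ht.trans hl.symm)⟩

/-- The quotient by a congruence. -/
def quot (A : DAlg.{u}) (r : Setoid A.carrier)
    (hr : ∀ x x' y y', r x x' → r y y' → r (A.d x y) (A.d x' y')) : DAlg.{u} where
  carrier := Quotient r
  d := Quotient.map₂ A.d fun x x' hx y y' hy => hr x x' y y' hx hy
  zero := Quotient.mk r A.zero
  d_self := by
    rintro ⟨x⟩
    exact congrArg (Quotient.mk r) (A.d_self x)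

/-- The projection onto a quotient. -/
def quotπ (A : DAlg.{u}) (r : Setoid A.carrier)
    (hr : ∀ x x' y y', r x x' → r y y' → r (A.d x y) (A.d x' y')) : A ⟶ A.quot r hr :=
  (⟨Quotient.mk r, fun _ _ => rfl, rfl⟩ : Hom _ _)

theorem quotπ_surjective (A : DAlg.{u}) (r : Setoid A.carrier)
    (hr : ∀ x x' y y', r x x' → r y y' → r (A.d x y) (A.d x' y')) :
    Function.Surjective (A.quotπ r hr).toFun :=
  Quotient.mk_surjective

theorem quotπ_eq_iff (A : DAlg.{u}) (r : Setoid A.carrier)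
    (hr : ∀ x x' y y', r x x' → r y y' → r (A.d x y) (A.d x' y')) {x y : A.carrier} :
    (A.quotπ r hr).toFun x = (A.quotπ r hr).toFun y ↔ r x y :=
  Quotient.eq

section Limits

variable {J : Type} [SmallCategory J] (F : J ⥤ DAlg.{u})

/-- The algebra of compatible families in a diagram. -/
def sections : DAlg.{u} where
  carrier := { s : ∀ j, (F.obj j).carrier // ∀ ⦃i j : J⦄ (f : i ⟶ j), (F.map f).toFun (s i) = s j }
  d s t := ⟨fun j => (F.obj j).d (s.1 j) (t.1 j), fun _ _ f => by
    rw [(F.map f).map_d, s.2, t.2]⟩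
  zero := ⟨fun j => (F.obj j).zero, fun _ _ f => (F.map f).map_zero⟩
  d_self s := Subtype.ext (funext fun j => (F.obj j).d_self _)

/-- The cone of the compatible families. -/
def sectionsCone : Cone F where
  pt := sections F
  π :=
    { app j := (⟨fun s => s.1 j, fun _ _ => rfl, rfl⟩ : Hom (sections F) (F.obj j))
      naturality _ _ f := hom_ext fun s => (s.2 f).symm }

/-- The compatible families form a limit. -/
def sectionsIsLimit : IsLimit (sectionsCone F) where
  lift s := (⟨fun x => ⟨fun j => (s.π.app j).toFun x, fun i j f => by
      rw [← comp_toFun, s.w]⟩,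
    fun x y => Subtype.ext (funext fun j => (s.π.app j).map_d x y),
    Subtype.ext (funext fun j => (s.π.app j).map_zero)⟩ : Hom s.pt (sections F))
  fac s j := rfl
  uniq s m hm := hom_ext fun x => Subtype.ext (funext fun j =>
    congrArg (fun g : s.pt ⟶ F.obj j => g.toFun x) (hm j))

instance : HasLimitsOfShape J DAlg.{u} :=
  ⟨fun F => ⟨⟨sectionsCone F, sectionsIsLimit F⟩⟩⟩

instance : HasFiniteLimits DAlg.{u} := ⟨fun _ => inferInstance⟩

end Limits

/-! ### Free algebras -/

/-- Terms in the variables `X`. -/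
inductive Term (X : Type u) : Type u
  | zero : Term X
  | var (x : X) : Term X
  | node (s t : Term X) : Term X

namespace Term

variable {X : Type u}

/-- A term is reduced when it has no subterm of the form `d(s, s)`. -/
def Reduced : Term X → Prop
  | zero => True
  | var _ => True
  | node s t => s.Reduced ∧ t.Reduced ∧ s ≠ t

/-- The value of a term in an algebra. -/
def eval (B : DAlg.{u}) (f : X → B.carrier) : Term X → B.carrier
  | zero => B.zero
  | var x => f x
  | node s t => B.d (s.eval B f) (t.eval B f)

end Term

open Classical in
/-- The free algebra on `X`, consisting of the reduced terms. -/
noncomputable def free (X : Type u) : DAlg.{u} where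
  carrier := { t : Term X // t.Reduced }
  d s t := if h : s = t then ⟨.zero, trivial⟩ else
    ⟨.node s.1 t.1, s.2, t.2, fun e => h (Subtype.ext e)⟩
  zero := ⟨.zero, trivial⟩
  d_self _ := dif_pos rfl

/-- The generators of a free algebra. -/
def freeVar {X : Type u} (x : X) : (free X).carrier := ⟨.var x, trivial⟩

theorem free_d_of_ne {X : Type u} {s t : (free X).carrier} (h : s ≠ t) :
    (free X).d s t = ⟨.node s.1 t.1, s.2, t.2, fun e => h (Subtype.ext e)⟩ :=
  dif_neg h

/-- On distinct reduced terms the operation builds a node, which is never the zero term. -/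
theorem free_quasiIdentity (X : Type u) : quasiIdentity (free X) := by
  intro s t h
  by_contra hne
  rw [free_d_of_ne hne] at h
  exact Term.noConfusion rfl (heq_of_eq (congrArg Subtype.val h))

/-- The homomorphism from a free algebra extending a map on the generators. -/
noncomputable def freeLift {X : Type u} {B : DAlg.{u}} (f : X → B.carrier) : free X ⟶ B :=
  (⟨fun t => t.1.eval B f, fun s t => by
    by_cases h : s = t
    · rw [h, (free X).d_self, B.d_self]
      rfl
    · rw [free_d_of_ne h]
      rfl, rfl⟩ : Hom (free X) B)

theorem freeLift_var {X : Type u} {B : DAlg.{u}} (f : X → B.carrier) (x : X) :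
    (freeLift f).toFun (freeVar x) = f x := rfl

theorem free_hom_ext {X : Type u} {B : DAlg.{u}} {f g : free X ⟶ B}
    (h : ∀ x, f.toFun (freeVar x) = g.toFun (freeVar x)) : f = g := by
  refine hom_ext ?_
  rintro ⟨t, ht⟩
  induction t with
  | zero => exact f.map_zero.trans g.map_zero.symm
  | var x => exact h x
  | node s t hs ht' =>
    -- The two subterms of a reduced node are distinct, so the node really is a value of the
    -- operation; hence the generators generate.
    have e : (⟨.node s t, ht⟩ : (free X).carrier) = (free X).d ⟨s, ht.1⟩ ⟨t, ht.2.1⟩ :=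
      (free_d_of_ne (s := ⟨s, ht.1⟩) (t := ⟨t, ht.2.1⟩)
        fun e => ht.2.2 (congrArg Subtype.val e)).symm
    exact (congrArg f.toFun e).trans ((f.map_d _ _).trans ((congrArg₂ B.d (hs _) (ht' _)).trans
      ((g.map_d _ _).symm.trans (congrArg g.toFun e.symm))))

theorem free_isFree (X : Type u) : isFree (free X) :=
  ⟨X, freeVar, fun _ f => ⟨freeLift f, fun x => freeLift_var f x, fun _ hg =>
    free_hom_ext fun x => (hg x).trans (freeLift_var f x).symm⟩⟩

/-- The universal property makes any free algebra a retract of the term model on the same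
generators. The section is injective, and the quasi-identity pulls back along it. -/
theorem isFree_le_quasiIdentity : isFree.{u} ≤ quasiIdentity.{u} := by
  rintro A ⟨X, i, hi⟩ x y hxy
  obtain ⟨h, hh, -⟩ := hi (free X) freeVar
  let h' : A ⟶ free X := h
  have key : h' ≫ freeLift i = 𝟙 A := (hi A i).unique
    (fun x => by rw [comp_toFun, show h'.toFun (i x) = freeVar x from hh x, freeLift_var])
    fun x => rfl
  have e : h'.toFun x = h'.toFun y := free_quasiIdentity X _ _ (by
    rw [← h'.map_d, hxy, h'.map_zero])
  rw [← id_toFun A x, ← id_toFun A y, ← key, comp_toFun, e, comp_toFun]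

/-- Preimages are chosen on generators only, so `p` and `q` need not be jointly injective. With `p =
q` this is projectivity; with the two legs of a pseudo-equivalence relation it lifts a pointwise
relation to a morphism. -/
theorem isFree_exists_lift {Q S Y Z : DAlg.{u}} (hQ : isFree Q) (p : S ⟶ Y) (q : S ⟶ Z)
    (f : Q ⟶ Y) (g : Q ⟶ Z) (h : ∀ x, ∃ s, p.toFun s = f.toFun x ∧ q.toFun s = g.toFun x) :
    ∃ l : Q ⟶ S, l ≫ p = f ∧ l ≫ q = g := by
  obtain ⟨X, i, hi⟩ := hQ
  choose s hp hq using h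
  obtain ⟨l, hl, -⟩ := hi S fun x => s (i x)
  let l' : Q ⟶ S := l
  have hl' : ∀ x, l'.toFun (i x) = s (i x) := hl
  refine ⟨l', (hi Y fun x => f.toFun (i x)).unique (y₁ := l' ≫ p) (y₂ := f) (fun x => ?_)
    fun x => rfl, (hi Z fun x => g.toFun (i x)).unique (y₁ := l' ≫ q) (y₂ := g) (fun x => ?_)
    fun x => rfl⟩
  · rw [comp_toFun, hl', hp]
  · rw [comp_toFun, hl', hq]

/-- An element of `A`, as a homomorphism from the free algebra on one generator. -/
noncomputable def point {A : DAlg.{u}} (a : A.carrier) : free PUnit.{u + 1} ⟶ A :=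
  freeLift fun _ => a

@[simp] theorem point_var {A : DAlg.{u}} (a : A.carrier) (x : PUnit) :
    (point a).toFun (freeVar x) = a := rfl

theorem point_comp {A B : DAlg.{u}} (a : A.carrier) (f : A ⟶ B) :
    point a ≫ f = point (f.toFun a) :=
  free_hom_ext fun _ => rfl

/-- The canonical homomorphism onto `A` from the free algebra on the elements of `A`. -/
noncomputable def cover (A : DAlg.{u}) : free A.carrier ⟶ A := freeLift id

theorem cover_surjective (A : DAlg.{u}) : Function.Surjective A.cover.toFun :=
  fun a => ⟨freeVar a, rfl⟩

/-! ### Regularity of the variety and of the quasi-variety -/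

/-- The functor `U` embeds `D` into the variety as a full subcategory closed under subalgebras and
containing the free algebra on one generator. -/
structure IsHereditary {D : Type w} [Category.{v} D] (U : D ⥤ DAlg.{u}) : Prop where
  full : U.Full
  faithful : U.Faithful
  free : U.essImage (free PUnit)
  sub : ∀ ⦃A : DAlg.{u}⦄ (X : D) (m : A ⟶ U.obj X), Function.Injective m.toFun → U.essImage A

theorem isHereditary_id : IsHereditary (𝟭 DAlg.{u}) where
  full := inferInstance
  faithful := inferInstance
  free := ⟨_, ⟨Iso.refl _⟩⟩
  sub A _ _ _ := ⟨A, ⟨Iso.refl _⟩⟩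

theorem isHereditary_quasiIdentity : IsHereditary quasiIdentity.{u}.ι where
  full := inferInstance
  faithful := inferInstance
  free := ⟨⟨_, free_quasiIdentity _⟩, ⟨Iso.refl _⟩⟩
  sub A X m hm := ⟨⟨A, fun x y h => hm (X.property _ _ (by
    change (quasiIdentity.ι.obj X).d _ _ = (quasiIdentity.ι.obj X).zero
    rw [← m.map_d, h, m.map_zero]))⟩, ⟨Iso.refl _⟩⟩

namespace IsHereditary

variable {D : Type w} [Category.{v} D] {U : D ⥤ DAlg.{u}} (hU : IsHereditary U)

include hU

/-- The set underlying a pullback is the pullback of the underlying sets. -/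
theorem exists_of_isPullback {W X Y Z : D} {p : W ⟶ X} {q : W ⟶ Y} {f : X ⟶ Z} {g : Y ⟶ Z}
    (h : IsPullback p q f g) (x : (U.obj X).carrier) (y : (U.obj Y).carrier)
    (e : (U.map f).toFun x = (U.map g).toFun y) :
    ∃ w, (U.map p).toFun w = x ∧ (U.map q).toFun w = y := by
  have := hU.full
  have := hU.faithful
  obtain ⟨G, ⟨i⟩⟩ := hU.free
  -- Elements are morphisms from the free algebra on one generator, so `x` and `y` form a cone; the
  -- required element is the value of its lift at the generator.
  have w : U.preimage (i.hom ≫ point x) ≫ f = U.preimage (i.hom ≫ point y) ≫ g :=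
    U.map_injective (by simp [point_comp, e])
  have key : ∀ {V : D} (r : W ⟶ V) (v : (U.obj V).carrier),
      h.lift _ _ w ≫ r = U.preimage (i.hom ≫ point v) →
      (U.map r).toFun ((U.map (h.lift _ _ w)).toFun (i.inv.toFun (freeVar ⟨⟩))) = v := by
    intro V r v hv
    rw [← comp_toFun, ← U.map_comp, hv, U.map_preimage, comp_toFun, inv_hom_toFun, point_var]
  exact ⟨_, key p x (h.lift_fst _ _ w), key q y (h.lift_snd _ _ w)⟩

theorem epi_of_surjective {X Y : D} (f : X ⟶ Y) (hf : Function.Surjective (U.map f).toFun) :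
    Epi f :=
  have := hU.faithful
  have := DAlg.epi_of_surjective _ hf
  U.epi_of_epi_map this

theorem exists_desc {X Y Z : D} (f : X ⟶ Y) (hf : Function.Surjective (U.map f).toFun) (g : X ⟶ Z)
    (h : ∀ x y, (U.map f).toFun x = (U.map f).toFun y → (U.map g).toFun x = (U.map g).toFun y) :
    ∃ l : Y ⟶ Z, f ≫ l = g := by
  have := hU.full
  have := hU.faithful
  obtain ⟨l, hl⟩ := DAlg.exists_desc _ hf _ h
  exact ⟨U.preimage l, U.map_injective (by rw [U.map_comp, U.map_preimage, hl])⟩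

/-- The morphism is a coequalizer of its kernel pair: the kernel pair contains every pair of
identified elements, so whatever coequalizes it descends. -/
theorem isRegularEpi_of_surjective [HasFiniteLimits D] {X Y : D} (f : X ⟶ Y)
    (hf : Function.Surjective (U.map f).toFun) : IsRegularEpi f := by
  have := hU.epi_of_surjective f hf
  refine ⟨⟨⟨_, pullback.fst f f, pullback.snd f f, pullback.condition,
    (nonempty_isColimit_cofork_of_exists_desc f _ fun Z g hg =>
      hU.exists_desc f hf g fun x y e => ?_).some⟩⟩⟩
  obtain ⟨w, rfl, rfl⟩ := hU.exists_of_isPullback (IsPullback.of_hasPullback f f) x y e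
  rw [← comp_toFun, ← comp_toFun, ← U.map_comp, hg, U.map_comp]

theorem exists_image {X Y : D} (f : X ⟶ Y) :
    ∃ (I : D) (e : X ⟶ I) (m : I ⟶ Y), Function.Surjective (U.map e).toFun ∧ Mono m ∧
      e ≫ m = f := by
  have := hU.full
  have := hU.faithful
  obtain ⟨I, e, m, he, hm, hf⟩ := DAlg.exists_image (U.map f)
  obtain ⟨I', ⟨i⟩⟩ := hU.sub Y m hm
  refine ⟨I', U.preimage (e ≫ i.inv), U.preimage (i.hom ≫ m), ?_, ?_,
    U.map_injective (by simp [hf])⟩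
  · rw [U.map_preimage]
    intro x
    obtain ⟨y, hy⟩ := he (i.hom.toFun x)
    exact ⟨y, by rw [comp_toFun, hy, hom_inv_toFun]⟩
  · have := mono_of_injective m hm
    apply U.mono_of_mono_map
    rw [U.map_preimage]
    infer_instance

/-- The mono part of the image factorization is also a strong epimorphism, hence invertible. -/
theorem surjective_of_isRegularEpi {X Y : D} (f : X ⟶ Y) (hf : IsRegularEpi f) :
    Function.Surjective (U.map f).toFun := by
  obtain ⟨I, e, m, he, hm, rfl⟩ := hU.exists_image f
  have : StrongEpi (e ≫ m) := inferInstance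
  have : StrongEpi m := strongEpi_of_strongEpi e m
  have : IsIso m := isIso_of_mono_of_strongEpi m
  intro y
  obtain ⟨x, hx⟩ := he ((U.mapIso (asIso m)).inv.toFun y)
  exact ⟨x, by
    rw [U.map_comp, comp_toFun, hx]
    exact inv_hom_toFun (U.mapIso (asIso m)) y⟩

theorem regular [HasFiniteLimits D] : Regular D where
  hasCoequalizer_of_isKernelPair := by
    intro X Y Z f g₁ g₂ h
    obtain ⟨I, e, m, he, hm, rfl⟩ := hU.exists_image f
    have := hU.isRegularEpi_of_surjective e he
    -- Composing with a monomorphism does not change the kernel pair, so the image projection is the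
    -- coequalizer.
    have h' : IsKernelPair e g₁ g₂ := h.cancel_right_of_mono
    exact ⟨⟨_, h'.toCoequalizer'⟩⟩
  regularEpiIsStableUnderBaseChange := ⟨fun h hf => by
    refine hU.isRegularEpi_of_surjective _ fun y => ?_
    obtain ⟨x, hx⟩ := hU.surjective_of_isRegularEpi _ hf ((U.map _).toFun y)
    obtain ⟨w, -, hw⟩ := hU.exists_of_isPullback h x y hx
    exact ⟨w, hw⟩⟩

/-- Regular epimorphisms are surjective, so freeness gives the lifts, and canonical covers supply
enough projectives. Requiring the composite with `U` only up to isomorphism lets the statement serve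
both the variety and the quasi-variety. -/
theorem isProjectiveCover [HasFiniteLimits D] (F : isFree.{u}.FullSubcategory ⥤ D)
    (i : F ⋙ U ≅ isFree.{u}.ι) : IsProjectiveCover F := by
  have := hU.full
  have := hU.faithful
  have : (F ⋙ U).Full := Functor.Full.of_iso i.symm
  have : (F ⋙ U).Faithful := Functor.Faithful.of_iso i.symm
  refine ⟨hU.regular, Functor.Full.of_comp_faithful F U, Functor.Faithful.of_comp F U, ?_, ?_⟩
  · intro Q X Y f hf g
    obtain ⟨l, hl, -⟩ := isFree_exists_lift Q.property (U.map f) (U.map f)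
      ((i.app Q).inv ≫ U.map g) ((i.app Q).inv ≫ U.map g) fun x => by
        simpa using hU.surjective_of_isRegularEpi f hf _
    exact ⟨U.preimage ((i.app Q).hom ≫ l), U.map_injective (by simp [hl])⟩
  · intro X
    let Q : isFree.{u}.FullSubcategory := ⟨_, free_isFree (U.obj X).carrier⟩
    refine ⟨Q, U.preimage ((i.app Q).hom ≫ (U.obj X).cover),
      hU.isRegularEpi_of_surjective _ fun x => ?_⟩
    obtain ⟨y, rfl⟩ := cover_surjective _ x
    exact ⟨(i.app Q).inv.toFun y, by rw [U.map_preimage, comp_toFun, inv_hom_toFun]⟩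

end IsHereditary

/-! ### Finite limits in the quasi-variety, exactness of the variety, normality of the quasi-variety
-/

instance : HasFiniteLimits quasiIdentity.{u}.FullSubcategory where
  out J _ _ :=
    have : quasiIdentity.{u}.IsClosedUnderLimitsOfShape J := ⟨by
      rintro A ⟨h⟩ x y hxy
      -- Limit projections separate points, and each component of `x` and `y` satisfies the premise
      -- of the quasi-identity.
      have e : point x = point y := h.isLimit.hom_ext fun j => by
        rw [point_comp, point_comp]
        refine congrArg point (h.prop_diag_obj j _ _ ?_)
        exact ((h.π.app j).map_d x y).symm.trans
          ((congrArg (h.π.app j).toFun hxy).trans (h.π.app j).map_zero)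
      exact congrArg (fun f : free PUnit ⟶ A => f.toFun (freeVar ⟨⟩)) e⟩
    inferInstance

/-- Testing on points, an internal equivalence relation is jointly injective and its image is a
congruence; it is then the kernel pair of the quotient projection. -/
theorem isBarrExact : IsBarrExact DAlg.{u} where
  regular := isHereditary_id.regular
  effective := by
    rintro R X p₁ p₂ ⟨⟨e⟩⟩
    have hmono : ∀ a b : R.carrier, p₁.toFun a = p₁.toFun b → p₂.toFun a = p₂.toFun b → a = b := by
      intro a b h₁ h₂
      have h := e.right_cancellation (point a) (point b) (by rw [point_comp, point_comp, h₁])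
        (by rw [point_comp, point_comp, h₂])
      exact congrArg (fun f : free PUnit ⟶ R => f.toFun (freeVar ⟨⟩)) h
    let r : Setoid X.carrier :=
      { r x y := ∃ a, p₁.toFun a = x ∧ p₂.toFun a = y
        iseqv :=
          { refl x := ⟨e.r.toFun x, by rw [← comp_toFun, e.reflexivity₁, id_toFun],
              by rw [← comp_toFun, e.reflexivity₂, id_toFun]⟩
            symm := by
              rintro _ _ ⟨a, rfl, rfl⟩
              exact ⟨e.s.toFun a, by rw [← comp_toFun, e.symmetry₁],
                by rw [← comp_toFun, e.symmetry₂]⟩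
            trans := by
              rintro _ _ _ ⟨a, rfl, rfl⟩ ⟨b, hb, rfl⟩
              obtain ⟨w, rfl, rfl⟩ := isHereditary_id.exists_of_isPullback
                (IsPullback.of_isLimit e.isLimit) a b hb.symm
              exact ⟨e.t.toFun w, by rw [← comp_toFun, e.transitivity₁]; rfl,
                by rw [← comp_toFun, e.transitivity₂]; rfl⟩ } }
    have hr : ∀ x x' y y', r x x' → r y y' → r (X.d x y) (X.d x' y') := by
      rintro _ _ _ _ ⟨a, rfl, rfl⟩ ⟨b, rfl, rfl⟩
      exact ⟨R.d a b, p₁.map_d a b, p₂.map_d a b⟩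
    have w : p₁ ≫ X.quotπ r hr = p₂ ≫ X.quotπ r hr :=
      hom_ext fun a => (X.quotπ_eq_iff r hr).2 ⟨a, rfl, rfl⟩
    have hlift : ∀ s : PullbackCone (X.quotπ r hr) (X.quotπ r hr),
        ∃ l : s.pt ⟶ R, l ≫ p₁ = s.fst ∧ l ≫ p₂ = s.snd := fun s =>
      exists_lift₂ p₁ p₂ hmono s.fst s.snd fun x => (X.quotπ_eq_iff r hr).1
        (congrArg (fun g : s.pt ⟶ X.quot r hr => g.toFun x) s.condition)
    choose l hl₁ hl₂ using hlift
    exact ⟨X.quot r hr, X.quotπ r hr, ⟨w⟩, ⟨PullbackCone.IsLimit.mk w l hl₁ hl₂ fun s m h₁ h₂ =>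
      e.right_cancellation _ _ (h₁.trans (hl₁ s).symm) (h₂.trans (hl₂ s).symm)⟩⟩

/-- If `g`, with values in the quasi-variety, kills the kernel of `f`, it identifies the elements
identified by `f`. -/
theorem toFun_eq_of_kernel {A B D : DAlg.{u}} (hD : quasiIdentity D) (f : A ⟶ B) (g : A ⟶ D)
    (h : ∀ x, f.toFun x = B.zero → g.toFun x = D.zero) (x y : A.carrier)
    (e : f.toFun x = f.toFun y) : g.toFun x = g.toFun y :=
  hD _ _ (by rw [← g.map_d, h _ (by rw [f.map_d, e, B.d_self])])

theorem isNormalCategory_quasiIdentity :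
    IsNormalCategory quasiIdentity.{u}.FullSubcategory where
  regular := isHereditary_quasiIdentity.regular
  normalEpi X Y f hf := by
    have hs := isHereditary_quasiIdentity.surjective_of_isRegularEpi f hf
    have := isHereditary_quasiIdentity.epi_of_surjective f hs
    obtain ⟨K, k, hk, hK⟩ := exists_kernel f.hom
    -- The kernel taken in the variety is a subalgebra of `X`, so it already lies in the
    -- quasi-variety.
    let K' : quasiIdentity.{u}.FullSubcategory := ⟨K, fun x y h => hk (X.property _ _ (by
      rw [← k.map_d, h, k.map_zero]))⟩
    let k' : K' ⟶ X := ObjectProperty.homMk k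
    have w : k' ≫ f = 0 := ObjectProperty.hom_ext _ (hom_ext fun x => (hK _).2 ⟨x, rfl⟩)
    refine ⟨⟨K', k', w, (nonempty_isColimit_cofork_of_exists_desc f (by rw [w, zero_comp])
      fun Z g hg => isHereditary_quasiIdentity.exists_desc f hs g
        (toFun_eq_of_kernel Z.property f.hom g.hom fun x hx => ?_)).some⟩⟩
    obtain ⟨y, rfl⟩ := (hK x).1 hx
    rw [zero_comp] at hg
    exact congrArg (fun g : K' ⟶ Z => g.hom.toFun y) hg

/-! ### Weak limits, weak kernels and the star condition for free algebras -/

theorem isFree_hasWeakFiniteLimits : HasWeakFiniteLimits isFree.{u}.FullSubcategory := by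
  intro J _ _
  refine ⟨fun F => ?_⟩
  let G := F ⋙ isFree.ι
  -- A free cover of the limit in the variety is a weak limit: cones factor through the limit, and
  -- projectivity lifts the factorization.
  let Q : isFree.{u}.FullSubcategory := ⟨free (limit G).carrier, free_isFree _⟩
  let c : Cone F :=
    { pt := Q
      π :=
        { app j := ObjectProperty.homMk ((limit G).cover ≫ limit.π G j)
          naturality i j f := ObjectProperty.hom_ext _ (by
            change 𝟙 _ ≫ (limit G).cover ≫ limit.π G j = ((limit G).cover ≫ limit.π G i) ≫ G.map f
            rw [Category.id_comp, Category.assoc, limit.w]) } }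
  have hlift : ∀ s : Cone F, ∃ l : s.pt ⟶ Q, ∀ j, l ≫ c.π.app j = s.π.app j := by
    intro s
    let t : s.pt.obj ⟶ limit G := limit.lift G (isFree.ι.mapCone s)
    obtain ⟨l, hl, -⟩ := isFree_exists_lift s.pt.property (limit G).cover (limit G).cover
      t t fun x => (cover_surjective _ (t.toFun x)).imp fun _ e => ⟨e, e⟩
    refine ⟨ObjectProperty.homMk l, fun j => ObjectProperty.hom_ext _ ?_⟩
    have h : (l ≫ (limit G).cover) ≫ limit.π G j = (isFree.ι.mapCone s).π.app j := by
      rw [hl]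
      exact limit.lift_π _ _
    exact h
  choose l hl using hlift
  exact ⟨⟨⟨c, ⟨l, hl⟩⟩⟩⟩

theorem isFree_hasWeakIdealKernels :
    HasWeakIdealKernels (nullIdeal isFree.{u}.FullSubcategory) := by
  intro X Y f
  obtain ⟨K, k, -, hk⟩ := exists_kernel f.hom
  refine ⟨⟨_, free_isFree K.carrier⟩, ObjectProperty.homMk (K.cover ≫ k),
    ObjectProperty.hom_ext _ (hom_ext fun x => (hk _).2 ⟨_, rfl⟩), fun K' k' h => ?_⟩
  obtain ⟨l, hl, -⟩ := isFree_exists_lift K'.property (K.cover ≫ k) (K.cover ≫ k) k'.hom k'.hom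
    fun x => by
      obtain ⟨y, hy⟩ := (hk (k'.hom.toFun x)).1
        (congrArg (fun g : K' ⟶ Y => g.hom.toFun x) (show k' ≫ f = 0 from h))
      obtain ⟨z, rfl⟩ := cover_surjective K y
      exact ⟨z, hy, hy⟩
  exact ⟨ObjectProperty.homMk l, ObjectProperty.hom_ext _ hl⟩

theorem isFree_reflexiveGraphsSatisfyStarPiZero :
    ReflexiveGraphsSatisfyStarPiZero (nullIdeal isFree.{u}.FullSubcategory) := by
  rintro G₁ G₀ d c ⟨e, hd, hc⟩ K k ⟨hk₀, hk⟩ Z g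
  refine ⟨fun h => ?_, fun h => by rw [h]⟩
  have hkd : k ≫ d = 0 := hk₀
  rw [reassoc_of% hkd, zero_comp] at h
  ext : 1
  refine hom_ext fun x => isFree_le_quasiIdentity _ Z.property _ _ ?_
  have hd' : ∀ y, d.hom.toFun (e.hom.toFun y) = y := fun y =>
    congrArg (fun f : G₀ ⟶ G₀ => f.hom.toFun y) hd
  have hc' : ∀ y, c.hom.toFun (e.hom.toFun y) = y := fun y =>
    congrArg (fun f : G₀ ⟶ G₀ => f.hom.toFun y) hc
  -- Since `e` splits both legs, the leg `d` kills this element while `c` sends it to the difference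
  -- of `d x` and `c x`. It factors through the weak kernel, so `c ≫ g` kills it too, and the
  -- quasi-identity in `Z` concludes.
  let a := G₁.obj.d (e.hom.toFun (d.hom.toFun x)) x
  let G : isFree.{u}.FullSubcategory := ⟨_, free_isFree PUnit⟩
  obtain ⟨t, ht⟩ := hk (K' := G) (ObjectProperty.homMk (point a)) (by
    refine ObjectProperty.hom_ext _ (free_hom_ext fun _ => ?_)
    change d.hom.toFun (G₁.obj.d _ _) = G₀.obj.zero
    rw [d.hom.map_d, hd', G₀.obj.d_self])
  have h' : (c ≫ g).hom.toFun a = Z.obj.zero := by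
    have : ObjectProperty.homMk (point a) ≫ c ≫ g = (0 : G ⟶ Z) := by
      rw [← ht, Category.assoc, ← h, comp_zero]
    exact congrArg (fun f : G ⟶ Z => f.hom.toFun (freeVar ⟨⟩)) this
  rw [Hom.map_d] at h'
  simpa [hc'] using h'

/-! ### Failure of normality and star-regularity in the variety -/

/-- The algebra with vanishing operation on a pointed set. -/
def trivialAlg (X : Type u) (x : X) : DAlg.{u} where
  carrier := X
  d _ _ := x
  zero := x
  d_self _ := rfl

/-- A surjective homomorphism with zero kernel which is not injective. -/
theorem exists_surjective_kernel_zero_not_injective :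
    ∃ (A B : DAlg.{u}) (f : A ⟶ B), Function.Surjective f.toFun ∧
      (∀ x, f.toFun x = B.zero → x = A.zero) ∧ ¬ Function.Injective f.toFun := by
  -- Two nonzero points are collapsed to a single nonzero point.
  refine ⟨trivialAlg (Option (ULift Bool)) none, trivialAlg (Option PUnit) none,
    (⟨Option.map fun _ => ⟨⟩, fun _ _ => rfl, rfl⟩ : Hom _ _), ?_, ?_, ?_⟩
  · rintro (_ | _)
    · exact ⟨none, rfl⟩
    · exact ⟨some ⟨true⟩, rfl⟩
  · rintro (_ | x) h
    · rfl
    · cases h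
  · intro h
    have := @h (some ⟨true⟩) (some ⟨false⟩) rfl
    cases this

theorem not_mono_of_not_injective {A B : DAlg.{u}} (f : A ⟶ B) (hf : ¬ Function.Injective f.toFun) :
    ¬ Mono f := fun _ => hf fun x y h => by
  have : point x = point y := (cancel_mono f).1 (by rw [point_comp, point_comp, h])
  exact congrArg (fun f : free PUnit ⟶ A => f.toFun (freeVar ⟨⟩)) this

theorem exists_isRegularEpi_kernel_zero_not_mono :
    ∃ (A B : DAlg.{u}) (f : A ⟶ B), IsRegularEpi f ∧
      (∀ ⦃K : DAlg.{u}⦄ (k : K ⟶ A), k ≫ f = 0 → k = 0) ∧ ¬ Mono f := by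
  obtain ⟨A, B, f, hs, hk, hf⟩ := exists_surjective_kernel_zero_not_injective
  exact ⟨A, B, f, isHereditary_id.isRegularEpi_of_surjective f hs, fun K k h => hom_ext fun x =>
    hk _ (congrArg (fun g : K ⟶ B => g.toFun x) h), not_mono_of_not_injective f hf⟩

theorem exists_isRegularEpi_not_normalEpi :
    ∃ (A B : DAlg.{u}) (f : A ⟶ B), IsRegularEpi f ∧ IsEmpty (NormalEpi f) := by
  obtain ⟨A, B, f, hr, hk, hf⟩ := exists_isRegularEpi_kernel_zero_not_mono
  refine ⟨A, B, f, hr, ⟨fun ⟨W, g, w, h⟩ => hf ?_⟩⟩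
  -- A morphism with cokernel `f` must be null, so the identity factors through `f`, which would
  -- make `f` a monomorphism.
  obtain ⟨l, hl⟩ := CokernelCofork.IsColimit.desc' h (𝟙 A) (by rw [hk g w, zero_comp])
  exact mono_of_mono_fac (h := 𝟙 A) hl

theorem not_isNormalCategory : ¬ IsNormalCategory DAlg.{u} := fun h => by
  obtain ⟨A, B, f, hr, hf⟩ := exists_isRegularEpi_not_normalEpi
  exact hf.false (h.normalEpi f hr).some

theorem not_isStarRegular : ¬ IsStarRegular (nullIdeal DAlg.{u}) := fun h => by
  obtain ⟨A, B, f, hr, hk, hf⟩ := exists_isRegularEpi_kernel_zero_not_mono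
  obtain ⟨K, k, hK⟩ := exists_isIdealKernel (pullback.fst f f)
  obtain ⟨w, ⟨hc⟩⟩ := h.coequalizer f hr _ _ k (IsPullback.of_hasPullback f f) hK
  have h₁ : k ≫ pullback.fst f f = 0 := hK.1
  -- Both legs of the kernel star are null, so its coequalizer is again a monomorphism.
  have h₂ : k ≫ pullback.snd f f = 0 := hk _ (by rw [← w, h₁, zero_comp])
  obtain ⟨l, hl⟩ := Cofork.IsColimit.desc' hc (𝟙 A) (by rw [h₁, h₂])
  exact hf (mono_of_mono_fac (h := 𝟙 A) hl)

/-! ### The exact completion of the category of free algebras -/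

section ExactCompletion

variable (A : PseudoEquivalenceRelation isFree.{u}.FullSubcategory)

/-- The congruence on the free algebra `X` given by the image of `R` in `X × X`. -/
def congruence : Setoid A.X.obj.carrier where
  r x y := ∃ a, A.r₁.hom.toFun a = x ∧ A.r₂.hom.toFun a = y
  iseqv :=
    { refl x := by
        obtain ⟨r, h₁, h₂⟩ := A.refl
        exact ⟨r.hom.toFun x, congrArg (fun f : A.X ⟶ A.X => f.hom.toFun x) h₁,
          congrArg (fun f : A.X ⟶ A.X => f.hom.toFun x) h₂⟩
      symm := by
        rintro _ _ ⟨a, rfl, rfl⟩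
        obtain ⟨s, h₁, h₂⟩ := A.symm
        exact ⟨s.hom.toFun a, congrArg (fun f : A.R ⟶ A.X => f.hom.toFun a) h₁,
          congrArg (fun f : A.R ⟶ A.X => f.hom.toFun a) h₂⟩
      trans := by
        rintro _ _ _ ⟨a, rfl, rfl⟩ ⟨b, hb, rfl⟩
        -- Transitivity is stated for all test objects; the free algebra on one generator turns it
        -- into a statement about elements.
        let G : isFree.{u}.FullSubcategory := ⟨_, free_isFree PUnit⟩
        let p : A.R.obj.carrier → (G ⟶ A.R) := fun a => ObjectProperty.homMk (point a)
        obtain ⟨t, h₁, h₂⟩ := A.trans (p a) (p b)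
          (ObjectProperty.hom_ext _ (free_hom_ext fun _ => hb.symm))
        exact ⟨t.hom.toFun (freeVar ⟨⟩),
          congrArg (fun f : G ⟶ A.X => f.hom.toFun (freeVar ⟨⟩)) h₁,
          congrArg (fun f : G ⟶ A.X => f.hom.toFun (freeVar ⟨⟩)) h₂⟩ }

theorem congruence_d (x x' y y' : A.X.obj.carrier) (h : congruence A x x')
    (h' : congruence A y y') : congruence A (A.X.obj.d x y) (A.X.obj.d x' y') := by
  obtain ⟨a, rfl, rfl⟩ := h
  obtain ⟨b, rfl, rfl⟩ := h'
  exact ⟨A.R.obj.d a b, A.r₁.hom.map_d a b, A.r₂.hom.map_d a b⟩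

/-- The quotient of `X` by the image of `R`. -/
def coeq : DAlg.{u} := A.X.obj.quot (congruence A) (congruence_d A)

/-- The projection of `X` onto its quotient. -/
def coeqπ : A.X.obj ⟶ coeq A := A.X.obj.quotπ (congruence A) (congruence_d A)

theorem coeqπ_surjective : Function.Surjective (coeqπ A).toFun := quotπ_surjective _ _ _

theorem coeqπ_eq_iff {x y : A.X.obj.carrier} :
    (coeqπ A).toFun x = (coeqπ A).toFun y ↔
      ∃ a, A.r₁.hom.toFun a = x ∧ A.r₂.hom.toFun a = y :=
  quotπ_eq_iff _ _ _

instance : Epi (coeqπ A) := epi_of_surjective _ (coeqπ_surjective A)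

end ExactCompletion

/-- A morphism witnessing that two representatives are equivalent puts their values in the same
class, so one induced map works for every representative. -/
theorem exists_coeqMap {A B : ExactCompletion isFree.{u}.FullSubcategory} (f : A ⟶ B) :
    ∃ l : coeq A.rel ⟶ coeq B.rel, ∀ f' : ExactCompletion.PreHom A B, Quotient.mk _ f' = f →
      coeqπ A.rel ≫ l = f'.1.hom ≫ coeqπ B.rel := by
  obtain ⟨f₀, rfl⟩ := Quotient.mk_surjective f
  obtain ⟨g, h₁, h₂⟩ := f₀.2
  obtain ⟨l, hl⟩ := exists_desc (coeqπ A.rel) (coeqπ_surjective _) (f₀.1.hom ≫ coeqπ B.rel) (by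
    intro x y hxy
    obtain ⟨a, rfl, rfl⟩ := (coeqπ_eq_iff _).1 hxy
    exact (coeqπ_eq_iff _).2 ⟨g.hom.toFun a,
      congrArg (fun f : A.rel.R ⟶ B.rel.X => f.hom.toFun a) h₁,
      congrArg (fun f : A.rel.R ⟶ B.rel.X => f.hom.toFun a) h₂⟩)
  refine ⟨l, fun f' hf' => hl.trans ?_⟩
  obtain ⟨h, h₁, h₂⟩ := Quotient.exact hf'
  exact hom_ext fun x => ((coeqπ_eq_iff _).2 ⟨h.hom.toFun x,
    congrArg (fun f : A.rel.X ⟶ B.rel.X => f.hom.toFun x) h₁,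
    congrArg (fun f : A.rel.X ⟶ B.rel.X => f.hom.toFun x) h₂⟩).symm

/-- The homomorphism between quotients induced by a morphism of the exact completion. -/
noncomputable def coeqMap {A B : ExactCompletion isFree.{u}.FullSubcategory} (f : A ⟶ B) :
    coeq A.rel ⟶ coeq B.rel :=
  (exists_coeqMap f).choose

theorem coeqπ_coeqMap {A B : ExactCompletion isFree.{u}.FullSubcategory}
    (f : ExactCompletion.PreHom A B) :
    coeqπ A.rel ≫ coeqMap (Quotient.mk _ f : A ⟶ B) = f.1.hom ≫ coeqπ B.rel :=
  (exists_coeqMap (Quotient.mk _ f : A ⟶ B)).choose_spec f rfl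

/-- The functor sending a pseudo-equivalence relation of free algebras to its quotient. -/
noncomputable def coeqFunctor : ExactCompletion isFree.{u}.FullSubcategory ⥤ DAlg.{u} where
  obj A := coeq A.rel
  map f := coeqMap f
  map_id A := by
    rw [← cancel_epi (coeqπ A.rel)]
    exact (coeqπ_coeqMap (ExactCompletion.PreHom.id A)).trans rfl
  map_comp {A B D} f g := by
    obtain ⟨f, rfl⟩ := Quotient.mk_surjective f
    obtain ⟨g, rfl⟩ := Quotient.mk_surjective g
    rw [← cancel_epi (coeqπ A.rel), ← Category.assoc, coeqπ_coeqMap, Category.assoc,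
      coeqπ_coeqMap, ← Category.assoc]
    exact coeqπ_coeqMap (f.comp g)

/-- If the induced maps agree, the values of the representatives are related pointwise; freeness of
the domain assembles the witnesses into a morphism to the relation. -/
instance : coeqFunctor.{u}.Faithful where
  map_injective {A B} f g h := by
    obtain ⟨f, rfl⟩ := Quotient.mk_surjective f
    obtain ⟨g, rfl⟩ := Quotient.mk_surjective g
    have e : f.1.hom ≫ coeqπ B.rel = g.1.hom ≫ coeqπ B.rel := by
      rw [← coeqπ_coeqMap, ← coeqπ_coeqMap]
      exact congrArg (coeqπ A.rel ≫ ·) h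
    obtain ⟨l, h₁, h₂⟩ := isFree_exists_lift A.rel.X.property B.rel.r₁.hom B.rel.r₂.hom f.1.hom
      g.1.hom fun x => (coeqπ_eq_iff _).1
        (congrArg (fun k : A.rel.X.obj ⟶ coeq B.rel => k.toFun x) e)
    exact Quotient.sound ⟨ObjectProperty.homMk l, ObjectProperty.hom_ext _ h₁,
      ObjectProperty.hom_ext _ h₂⟩

/-- Freeness is used twice: for `A.rel.X` to lift the map of quotients to the covering algebras, and
for `A.rel.R` to lift its compatibility with the relations. -/
instance : coeqFunctor.{u}.Full where
  map_surjective {A B} k := by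
    change coeq A.rel ⟶ coeq B.rel at k
    obtain ⟨f, hf, -⟩ := isFree_exists_lift A.rel.X.property (coeqπ B.rel) (coeqπ B.rel)
      (coeqπ A.rel ≫ k) (coeqπ A.rel ≫ k) fun x =>
        (coeqπ_surjective _ _).imp fun _ e => ⟨e, e⟩
    obtain ⟨g, h₁, h₂⟩ := isFree_exists_lift A.rel.R.property B.rel.r₁.hom B.rel.r₂.hom
      (A.rel.r₁.hom ≫ f) (A.rel.r₂.hom ≫ f) fun a => (coeqπ_eq_iff _).1 (by
        rw [← comp_toFun, ← comp_toFun, Category.assoc, Category.assoc, hf, comp_toFun,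
          comp_toFun, comp_toFun, comp_toFun, (coeqπ_eq_iff A.rel).2 ⟨a, rfl, rfl⟩])
    let f' : ExactCompletion.PreHom A B := ⟨ObjectProperty.homMk f, ObjectProperty.homMk g,
      ObjectProperty.hom_ext _ h₁, ObjectProperty.hom_ext _ h₂⟩
    exact ⟨Quotient.mk _ f', (cancel_epi (coeqπ A.rel)).1 ((coeqπ_coeqMap f').trans hf)⟩

/-- An algebra is the quotient of its canonical cover by a cover of the kernel pair. -/
theorem exists_pseudoEquivalenceRelation (A : DAlg.{u}) :
    ∃ R : PseudoEquivalenceRelation isFree.{u}.FullSubcategory, Nonempty (coeq R ≅ A) := by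
  let X : isFree.{u}.FullSubcategory := ⟨free A.carrier, free_isFree _⟩
  let K := pullback A.cover A.cover
  let p₁ : K ⟶ X.obj := pullback.fst _ _
  let p₂ : K ⟶ X.obj := pullback.snd _ _
  let R : isFree.{u}.FullSubcategory := ⟨free K.carrier, free_isFree _⟩
  let r₁ : R ⟶ X := ObjectProperty.homMk (K.cover ≫ p₁)
  let r₂ : R ⟶ X := ObjectProperty.homMk (K.cover ≫ p₂)
  have hw : ∀ a, A.cover.toFun (r₁.hom.toFun a) = A.cover.toFun (r₂.hom.toFun a) := fun a =>
    congrArg (fun f : K ⟶ A => f.toFun (K.cover.toFun a)) pullback.condition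
  have hR : ∀ x y, A.cover.toFun x = A.cover.toFun y →
      ∃ a, r₁.hom.toFun a = x ∧ r₂.hom.toFun a = y := by
    intro x y h
    obtain ⟨k, h₁, h₂⟩ := isHereditary_id.exists_of_isPullback
      (IsPullback.of_hasPullback A.cover A.cover) x y h
    obtain ⟨a, rfl⟩ := cover_surjective K k
    exact ⟨a, h₁, h₂⟩
  -- Pairs of morphisms from a free algebra that agree after the cover lift to `R`; reflexivity,
  -- symmetry and transitivity are all instances.
  have hlift : ∀ {T : isFree.{u}.FullSubcategory} (f g : T ⟶ X),
      (∀ x, A.cover.toFun (f.hom.toFun x) = A.cover.toFun (g.hom.toFun x)) →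
      ∃ t : T ⟶ R, t ≫ r₁ = f ∧ t ≫ r₂ = g := by
    intro T f g h
    obtain ⟨l, h₁, h₂⟩ := isFree_exists_lift T.property r₁.hom r₂.hom f.hom g.hom
      fun x => hR _ _ (h x)
    exact ⟨ObjectProperty.homMk l, ObjectProperty.hom_ext _ h₁, ObjectProperty.hom_ext _ h₂⟩
  let S : PseudoEquivalenceRelation isFree.{u}.FullSubcategory :=
    { X := X
      R := R
      r₁ := r₁
      r₂ := r₂
      refl := hlift _ _ fun _ => rfl
      symm := hlift _ _ fun x => (hw x).symm
      trans T a b h := hlift _ _ fun x => (hw _).trans ((congrArg A.cover.toFun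
        (congrArg (fun f : T ⟶ X => f.hom.toFun x) h)).trans (hw _)) }
  obtain ⟨l, hl⟩ := exists_desc (coeqπ S) (coeqπ_surjective S) A.cover fun x y h => by
    obtain ⟨a, rfl, rfl⟩ := (coeqπ_eq_iff S).1 h
    exact hw a
  have hl' : ∀ x, l.toFun ((coeqπ S).toFun x) = A.cover.toFun x := fun x =>
    congrArg (fun f : X.obj ⟶ A => f.toFun x) hl
  obtain ⟨e, -⟩ := exists_iso_of_bijective l ⟨fun x y h => by
    obtain ⟨x, rfl⟩ := coeqπ_surjective S x
    obtain ⟨y, rfl⟩ := coeqπ_surjective S y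
    rw [hl', hl'] at h
    exact (coeqπ_eq_iff S).2 (hR _ _ h), fun a => by
    obtain ⟨x, rfl⟩ := cover_surjective A a
    exact ⟨_, hl' x⟩⟩
  exact ⟨S, ⟨e⟩⟩

instance : coeqFunctor.{u}.EssSurj where
  mem_essImage A := by
    obtain ⟨R, h⟩ := exists_pseudoEquivalenceRelation A
    exact ⟨⟨R⟩, h⟩

instance : coeqFunctor.{u}.IsEquivalence where

/-- On the embedded free algebras the quotient functor is the inclusion. -/
theorem nonempty_embedding_comp_coeqFunctor_iso :
    Nonempty (ExactCompletion.embedding _ ⋙ coeqFunctor.{u} ≅ isFree.{u}.ι) := by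
  have h : ∀ X : isFree.{u}.FullSubcategory,
      ∃ e : X.obj ≅ coeq ((ExactCompletion.embedding _).obj X).rel, e.hom = coeqπ
      ((ExactCompletion.embedding _).obj X).rel := by
    intro X
    refine exists_iso_of_bijective (coeqπ ((ExactCompletion.embedding _).obj X).rel)
      ⟨fun x y h => ?_, coeqπ_surjective _⟩
    -- Both legs of the discrete relation are identities, so its congruence is equality.
    obtain ⟨a, h₁, h₂⟩ := (coeqπ_eq_iff _).1 h
    exact h₁.symm.trans h₂
  choose e he using h
  refine ⟨(NatIso.ofComponents (F := isFree.ι)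
    (G := ExactCompletion.embedding _ ⋙ coeqFunctor.{u}) e fun {X Y} f => ?_).symm⟩
  rw [he, he]
  exact (coeqπ_coeqMap (A := (ExactCompletion.embedding _).obj X)
    (B := (ExactCompletion.embedding _).obj Y) ⟨f, f, by simp [ExactCompletion.embedding],
      by simp [ExactCompletion.embedding]⟩).symm

/-- The inverse equivalence preserves coequalizers and reflects normal epimorphisms, so it carries
the counterexample over from the variety. -/
theorem not_isNormalCategory_exactCompletion :
    ¬ IsNormalCategory (ExactCompletion isFree.{u}.FullSubcategory) := fun h => by
  obtain ⟨A, B, f, hr, hf⟩ := exists_isRegularEpi_not_normalEpi.{u}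
  have : IsRegularEpi (coeqFunctor.inv.map f) := by
    obtain ⟨⟨r⟩⟩ := hr
    exact ⟨⟨⟨_, _, _, _, isColimitCoforkMapOfIsColimit coeqFunctor.inv r.w r.isColimit⟩⟩⟩
  obtain ⟨n⟩ := h.normalEpi _ this
  exact hf.false (equivalenceReflectsNormalEpi coeqFunctor.inv n)

end DAlg

theorem mainTheorem7 :
    -- the variety is an exact (in particular regular) pointed category with kernels
    IsBarrExact DAlg.{u} ∧
    HasIdealKernels (nullIdeal DAlg.{u}) ∧
    -- the free algebras form a projective cover of the variety and of the quasi-variety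
    IsProjectiveCover DAlg.isFree.{u}.ι ∧
    (∃ h : DAlg.isFree.{u} ≤ DAlg.quasiIdentity.{u},
      IsProjectiveCover (ObjectProperty.ιOfLE h)) ∧
    -- the quasi-variety is normal
    IsNormalCategory DAlg.quasiIdentity.{u}.FullSubcategory ∧
    -- reflexive graphs of free algebras satisfy the star condition
    HasWeakFiniteLimits DAlg.isFree.{u}.FullSubcategory ∧
    HasWeakIdealKernels (nullIdeal DAlg.isFree.{u}.FullSubcategory) ∧
    ReflexiveGraphsSatisfyStarPiZero (nullIdeal DAlg.isFree.{u}.FullSubcategory) ∧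
    -- the variety is not normal, equivalently not star-regular
    ¬ IsNormalCategory DAlg.{u} ∧
    ¬ IsStarRegular (nullIdeal DAlg.{u}) ∧
    -- the converse implication fails for a general projective cover
    (¬ ∀ (C : Type (u + 1)) [Category.{u} C] (N : MorphismProperty C) (P : ObjectProperty C),
      Regular C → IsMorphismIdeal N → HasIdealKernels N → IsProjectiveCover P.ι →
      ReflexiveGraphsSatisfyStarPiZero (N.inverseImage P.ι) → IsStarRegular N) ∧
    -- the variety is the exact completion of the category of free algebras, which is not normal
    (∃ E : ExactCompletion DAlg.isFree.{u}.FullSubcategory ≌ DAlg.{u},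
      Nonempty (ExactCompletion.embedding _ ⋙ E.functor ≅ DAlg.isFree.{u}.ι)) ∧
    ¬ IsNormalCategory (ExactCompletion DAlg.isFree.{u}.FullSubcategory) := by
  refine ⟨DAlg.isBarrExact, fun _ _ f => DAlg.exists_isIdealKernel f,
    DAlg.isHereditary_id.isProjectiveCover _ (Functor.rightUnitor _),
    ⟨DAlg.isFree_le_quasiIdentity, DAlg.isHereditary_quasiIdentity.isProjectiveCover _ (Iso.refl _)⟩,
    DAlg.isNormalCategory_quasiIdentity, DAlg.isFree_hasWeakFiniteLimits,
    DAlg.isFree_hasWeakIdealKernels, DAlg.isFree_reflexiveGraphsSatisfyStarPiZero,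
    DAlg.not_isNormalCategory, DAlg.not_isStarRegular, fun h => ?_,
    ⟨DAlg.coeqFunctor.asEquivalence, DAlg.nonempty_embedding_comp_coeqFunctor_iso⟩,
    DAlg.not_isNormalCategory_exactCompletion⟩
  -- Restricting the null ideal to free algebras gives their own null ideal, so the variety with its
  -- free algebras refutes the implication.
  have hN : (nullIdeal DAlg.{u}).inverseImage DAlg.isFree.ι =
      nullIdeal DAlg.isFree.{u}.FullSubcategory := by
    ext X Y f
    exact ⟨fun e => ObjectProperty.hom_ext _ e, fun e => congrArg InducedCategory.Hom.hom e⟩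
  exact DAlg.not_isStarRegular (h DAlg.{u} (nullIdeal DAlg.{u}) DAlg.isFree
    DAlg.isBarrExact.regular (nullIdeal_isMorphismIdeal _)
    (fun _ _ f => DAlg.exists_isIdealKernel f)
    (DAlg.isHereditary_id.isProjectiveCover _ (Functor.rightUnitor _))
    (hN ▸ DAlg.isFree_reflexiveGraphsSatisfyStarPiZero))
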